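/- Let $q,a_0\in\mathbb{C}\setminus\{0\}$ and let $D\subset\mathbb{C}\setminus\{0\}$ be a set with $c\in D\iff qc\in D$ (for instance $D=\mathbb{C}\setminus\{0\}$). Let $(G_\nu)_{\nu\in\mathbb{Z}}$ be complex-valued functions on $D$ satisfying, for all $\nu\in\mathbb{Z}$ and $c\in D$, the contiguity relations $$G_{\nu+1}(qc)=G_\nu(qc)+a_0^2q^{2\nu}c^2G_\nu(c),\qquad G_{\nu+1}(c)=G_\nu(qc)+c^2G_\nu(c).$$ For integers $N\ge 0$ and $\nu$ define the Toeplitz determinants $$\phi_N^\nu(c)=\det\bigl(G_{\nu-i+j}(c)\bigr)_{i,j=1,\dots,N}\quad(N\ge1),\qquad \phi_0^\nu(c)=1.$$ Then for all $\nu\in\mathbb{Z}$, all $c\in D$ and all integers $N\ge0$ (respectively $N\ge1$ in the equations (4), (5), (8), in which $\phi_{N-1}$ occurs) the following bilinear equations hold: \begin{align*} (1)\quad& a_0^2c^2q^{2\nu}\phi_N^\nu(qc)\phi_{N+1}^\nu(c)+\phi_N^\nu(c)\phi_{N+1}^\nu(qc)=q^{-2N}\phi_{N+1}^{\nu+1}(qc)\phi_N^{\nu-1}(c),\\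 (2)\quad& a_0^2q^{2\nu}\phi_N^{\nu}(qc)\phi_{N+1}^{\nu+1}(c)-\phi_N^{\nu}(c)\phi_{N+1}^{\nu+1}(qc)=(a_0^2q^{2\nu}-q^{2N})\phi_{N+1}^{\nu}(qc)\phi_N^{\nu+1}(c),\\ (3)\quad& \phi_{N+1}^{\nu+1}(qc)\phi_{N}^{\nu}(c)-q^{2N}\phi_{N+1}^{\nu+1}(c)\phi_N^{\nu}(qc)=c^2(a_0^2q^{2\nu}-q^{2N})\phi_{N+1}^{\nu}(c)\phi_N^{\nu+1}(qc),\\ (4)\quad& \phi_N^{\nu+1}(qc)\phi_{N}^{\nu}(c)-\phi_{N}^{\nu+1}(c)\phi_N^{\nu}(qc)=-\phi_{N-1}^{\nu}(qc)\phi_{N+1}^{\nu+1}(c),\\ (5)\quad& \phi_N^{\nu+1}(qc)\phi_N^\nu(c)-q^{2N}\phi_N^{\nu+1}(c)\phi_N^\nu(qc)=\frac{1}{a_0^2q^{2\nu}c^2}\phi_{N+1}^{\nu+1}(qc)\phi_{N-1}^{\nu}(c),\\ (6)\quad& q^{2N}\phi_N^{\nu}(c)\phi_{N+1}^\nu(c)-\phi_{N+1}^{\nu+1}(c)\phi_N^{\nu-1}(c)=-a_0^2c^2q^{2(\nu-1)}\phi_{N+1}^{\nu}(q^{-1}c)\phi_N^\nu(qc),\\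 (7)\quad& \phi_N^{\nu}(c)\phi_{N+1}^{\nu+1}(c)+c^2(a_0^2q^{2\nu}-q^{2N})\phi_{N+1}^{\nu}(c)\phi_N^{\nu+1}(c)=q^{-2N}\phi_{N}^{\nu}(q^{-1}c)\phi_{N+1}^{\nu+1}(qc),\\ (8)\quad& a_0^2q^{2\nu}\phi_N^{\nu}(c)\phi_N^{\nu+1}(c)+\phi_{N+1}^{\nu+1}(c)\phi_{N-1}^\nu(c)=a_0^2q^{2\nu}\phi_N^{\nu+1}(q^{-1}c)\phi_N^{\nu}(qc). \end{align*} -/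

import Mathlib

/-- The two contiguity relations (shift of `ν` against shift `c ↦ q c`) for a family of functions
`G ν`, `ν ∈ ℤ`, of a variable `c` ranging over a set `D` of complex numbers:
`G_{ν+1}(qc) = G_ν(qc) + a₀² q^{2ν} c² G_ν(c)` and `G_{ν+1}(c) = G_ν(qc) + c² G_ν(c)`. -/
structure SatisfiesContiguity (q a₀ : ℂ) (D : Set ℂ) (G : ℤ → ℂ → ℂ) : Prop where
  shift_qc : ∀ ν : ℤ, ∀ c ∈ D,
    G (ν + 1) (q * c) = G ν (q * c) + a₀ ^ 2 * q ^ (2 * ν) * c ^ 2 * G ν c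
  shift_c : ∀ ν : ℤ, ∀ c ∈ D,
    G (ν + 1) c = G ν (q * c) + c ^ 2 * G ν c

/-- The `N × N` Toeplitz determinant `φ_N^ν(c) = det (G_{ν-i+j}(c))_{i,j=1,…,N}`.
Only `j - i` enters, so indexing by `0,…,N-1` gives the same matrix; for `N = 0` the value is `1`. -/
noncomputable def toeplitzPhi (G : ℤ → ℂ → ℂ) (N : ℕ) (ν : ℤ) (c : ℂ) : ℂ :=
  Matrix.det (Matrix.of fun i j : Fin N => G (ν - ((i : ℕ) : ℤ) + ((j : ℕ) : ℤ)) c)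

/-! Fix `c` and put `x k = G k c`, `y k = G k (q * c)`, `z k = G k (q⁻¹ * c)`. The contiguity
relations become constant-coefficient first-order recursions `x (k+1) = c² x k + y k`, `y (k+1) = y
k + g k` and, at `q⁻¹ * c`, `x (k+1) = x k + ζ k`, where `g` and `ζ` are `x` and `z` multiplied by
geometric sequences. Such a factor changes a Toeplitz determinant only by an explicit scalar
(`toep_geometric`).

If `f (k+1) = s f k + g k`, subtracting `s` times the preceding column turns the Toeplitz
determinant of `f` into that of `g` bordered by one column of `f` (`toepCons_eq_toep`). Determinants
of `f` and `g` are then minors of one array of columns, and Plücker relations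
(`rowDet_exchange_three`) give bilinear identities. The pairs `(x, y)` and `(y, g)` yield all
relations between `c` and `q * c` alone.

Those containing `q⁻¹ * c` use `x` eliminated twice, with border columns `x, y` on `g`
(`toepConsCons_eq_toep`), and the fact that `ζ` obeys the recursion of `x` with `g` in place of `y`.
Plücker relations then also involve columns of `x` bordering `g`, which are not Toeplitz
determinants; combining two relations cancels them. -/

/-! ### Plücker relations for determinants. -/

section RowDet

variable {R : Type*} [CommRing R]

/-- The determinant of the first `n` coordinates of `n` sequences, as an alternating map. -/
noncomputable def rowDet (R : Type*) [CommRing R] (n : ℕ) : (ℕ → R) [⋀^Fin n]→ₗ[R] R :=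
  (Matrix.detRowAlternating (n := Fin n) (R := R)).compLinearMap
    (LinearMap.funLeft R R (fun i : Fin n => (i : ℕ)))

theorem rowDet_apply (n : ℕ) (U : Fin n → ℕ → R) :
    rowDet R n U = Matrix.det (Matrix.of fun j i : Fin n => U j i) := rfl

theorem rowDet_cons_add (n : ℕ) (p r : ℕ → R) (U : Fin n → ℕ → R) :
    rowDet R (n + 1) (Fin.cons (p + r) U)
      = rowDet R (n + 1) (Fin.cons p U) + rowDet R (n + 1) (Fin.cons r U) :=
  MultilinearMap.cons_add (rowDet R (n + 1)).toMultilinearMap U p r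

theorem rowDet_cons_smul (n : ℕ) (a : R) (p : ℕ → R) (U : Fin n → ℕ → R) :
    rowDet R (n + 1) (Fin.cons (a • p) U) = a * rowDet R (n + 1) (Fin.cons p U) :=
  MultilinearMap.cons_smul (rowDet R (n + 1)).toMultilinearMap U a p

theorem rowDet_cons_eq_zero (n : ℕ) (p : ℕ → R) (U : Fin n → ℕ → R) (h : ∃ j, U j = p) :
    rowDet R (n + 1) (Fin.cons p U) = 0 := by
  obtain ⟨j, rfl⟩ := h
  exact (rowDet R (n + 1)).map_eq_zero_of_eq _ (i := 0) (j := j.succ) (by simp)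
    (Fin.succ_ne_zero j).symm

theorem rowDet_cons_cons_swap (n : ℕ) (p r : ℕ → R) (U : Fin n → ℕ → R) :
    rowDet R (n + 2) (Fin.cons p (Fin.cons r U))
      = -rowDet R (n + 2) (Fin.cons r (Fin.cons p U)) := by
  rw [← (rowDet R (n + 2)).map_swap _ (i := 0) (j := 1) (by simp)]
  congr 1
  funext j
  refine Fin.cases ?_ (fun j => Fin.cases ?_ (fun j => ?_) j) j
  · simp
  · rw [Function.comp_apply, show (0 : Fin (n + 1)).succ = 1 from rfl, Equiv.swap_apply_right]
    rfl
  · have h : Equiv.swap (0 : Fin (n + 2)) 1 j.succ.succ = j.succ.succ :=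
      Equiv.swap_apply_of_ne_of_ne (Fin.succ_ne_zero _)
        (fun h => Fin.succ_ne_zero j (Fin.succ_injective _ h))
    rw [Function.comp_apply, h]
    rfl

/-- Expansion along the first basis vector. -/
theorem rowDet_cons_single_zero (n : ℕ) (U : Fin n → ℕ → R) :
    rowDet R (n + 1) (Fin.cons (Pi.single 0 1) U) = rowDet R n (fun j i => U j (i + 1)) := by
  rw [rowDet_apply, rowDet_apply, Matrix.det_succ_row_zero, Finset.sum_eq_single 0]
  · simp
    rfl
  · intro b _ hb
    have : (b : ℕ) ≠ 0 := fun h => hb (Fin.ext h)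
    simp [this]
  · simp

/-- Expansion along the last basis vector. -/
theorem rowDet_cons_single_last (n : ℕ) (U : Fin n → ℕ → R) :
    rowDet R (n + 1) (Fin.cons (Pi.single n 1) U) = (-1) ^ n * rowDet R n U := by
  rw [rowDet_apply, rowDet_apply, Matrix.det_succ_row_zero, Finset.sum_eq_single (Fin.last n)]
  · simp
    rfl
  · intro b _ hb
    have : (b : ℕ) ≠ n := fun h => hb (Fin.ext h)
    simp [this]
  · simp

/-- The linear relation between `n + 1` vectors in dimension `n`. -/
theorem sum_rowDet_succAbove_mul (n : ℕ) (u : Fin (n + 1) → ℕ → R) (k : Fin n) :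
    ∑ i : Fin (n + 1), (-1) ^ (i : ℕ) * u i k * rowDet R n (fun j => u (i.succAbove j)) = 0 := by
  -- Repeating coordinate `k` as an extra column gives a singular square matrix; the claim is its
  -- expansion along that column.
  have h : Matrix.det (Matrix.of fun (i : Fin (n + 1)) (j : Fin (n + 1)) =>
      (Fin.cons (u i k) (fun l : Fin n => u i l) : Fin (n + 1) → R) j) = 0 :=
    Matrix.det_zero_of_column_eq (i := 0) (j := k.succ) (Fin.succ_ne_zero k).symm (by simp)
  rw [Matrix.det_succ_column_zero] at h
  rw [← h]
  refine Finset.sum_congr rfl fun i _ => ?_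
  simp [rowDet_apply]
  rfl

/-- The general Plücker relation: the second factor is linear in `u i`, so the linear dependence
among the `u i` kills the sum coordinate by coordinate. -/
theorem sum_rowDet_succAbove_mul_rowDet_cons (n : ℕ) (u : Fin (n + 2) → ℕ → R)
    (B : Fin n → ℕ → R) :
    ∑ i : Fin (n + 2), (-1) ^ (i : ℕ) * rowDet R (n + 1) (fun j => u (i.succAbove j))
      * rowDet R (n + 1) (Fin.cons (u i) B) = 0 := by
  have key : ∀ p : ℕ → R, rowDet R (n + 1) (Fin.cons p B)
      = ∑ k : Fin (n + 1), p k * ((-1) ^ (k : ℕ) * Matrix.det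
          (Matrix.of fun j l : Fin n => B j (k.succAbove l))) := by
    intro p
    rw [rowDet_apply, Matrix.det_succ_row_zero]
    refine Finset.sum_congr rfl fun k _ => ?_
    simp only [Matrix.of_apply, Fin.cons_zero]
    rw [show (Matrix.of fun j i : Fin (n + 1) => (Fin.cons p B : Fin (n + 1) → ℕ → R) j i).submatrix
      Fin.succ k.succAbove = Matrix.of fun j l : Fin n => B j (k.succAbove l) by
        ext; simp]
    ring
  simp_rw [key, Finset.mul_sum]
  rw [Finset.sum_comm]
  refine Finset.sum_eq_zero fun k _ => ?_
  have := sum_rowDet_succAbove_mul (n + 1) u k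
  calc _ = (∑ i : Fin (n + 2), (-1) ^ (i : ℕ) * u i k *
        rowDet R (n + 1) (fun j => u (i.succAbove j))) * ((-1) ^ (k : ℕ) * Matrix.det
          (Matrix.of fun j l : Fin n => B j (k.succAbove l))) := by
        rw [Finset.sum_mul]
        exact Finset.sum_congr rfl fun i _ => by ring
    _ = 0 := by rw [this, zero_mul]

/-- Three-term exchange relation. -/
theorem rowDet_exchange_three (m : ℕ) (a b c : ℕ → R) (A : Fin m → ℕ → R)
    (B : Fin (m + 1) → ℕ → R) (hAB : ∀ i, ∃ j, B j = A i) :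
    rowDet R (m + 2) (Fin.cons b (Fin.cons c A)) * rowDet R (m + 2) (Fin.cons a B)
      - rowDet R (m + 2) (Fin.cons a (Fin.cons c A)) * rowDet R (m + 2) (Fin.cons b B)
      + rowDet R (m + 2) (Fin.cons a (Fin.cons b A)) * rowDet R (m + 2) (Fin.cons c B) = 0 := by
  have h := sum_rowDet_succAbove_mul_rowDet_cons (m + 1)
    (Fin.cons a (Fin.cons b (Fin.cons c A))) B
  rw [Fin.sum_univ_succ, Fin.sum_univ_succ, Fin.sum_univ_succ, Finset.sum_eq_zero] at h
  · have e1 : (fun j => (Fin.cons a (Fin.cons b (Fin.cons c A)) : Fin (m + 3) → ℕ → R)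
        ((0 : Fin (m + 3)).succAbove j)) = Fin.cons b (Fin.cons c A) := by
      funext j; simp
    have e2 : (fun j => (Fin.cons a (Fin.cons b (Fin.cons c A)) : Fin (m + 3) → ℕ → R)
        ((0 : Fin (m + 2)).succ.succAbove j)) = Fin.cons a (Fin.cons c A) := by
      funext j
      refine Fin.cases ?_ (fun j => ?_) j <;>
        simp only [Fin.succ_succAbove_zero, Fin.succ_succAbove_succ, Fin.succAbove_zero,
          Fin.cons_zero, Fin.cons_succ]
    have e3 : (fun j => (Fin.cons a (Fin.cons b (Fin.cons c A)) : Fin (m + 3) → ℕ → R)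
        ((0 : Fin (m + 1)).succ.succ.succAbove j)) = Fin.cons a (Fin.cons b A) := by
      funext j
      refine Fin.cases ?_ (fun j => Fin.cases ?_ (fun j => ?_) j) j <;>
        simp only [Fin.succ_succAbove_zero, Fin.succ_succAbove_succ, Fin.succAbove_zero,
          Fin.cons_zero, Fin.cons_succ]
    rw [e1, e2, e3] at h
    simp only [Fin.cons_zero, Fin.cons_succ, Fin.val_succ, Fin.val_zero] at h
    linear_combination h
  -- Exchanging a vector of `A` into `B` repeats a vector, so only the terms of `a`, `b`, `c`
  -- survive.
  · intro i _
    rw [Fin.cons_succ, Fin.cons_succ, Fin.cons_succ, rowDet_cons_eq_zero _ _ _ (hAB i), mul_zero]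

/-- Four-term exchange relation. -/
theorem rowDet_exchange_four (m : ℕ) (a b c d : ℕ → R) (A : Fin m → ℕ → R)
    (B : Fin (m + 2) → ℕ → R) (hAB : ∀ i, ∃ j, B j = A i) :
    rowDet R (m + 3) (Fin.cons b (Fin.cons c (Fin.cons d A))) * rowDet R (m + 3) (Fin.cons a B)
      - rowDet R (m + 3) (Fin.cons a (Fin.cons c (Fin.cons d A)))
          * rowDet R (m + 3) (Fin.cons b B)
      + rowDet R (m + 3) (Fin.cons a (Fin.cons b (Fin.cons d A)))
          * rowDet R (m + 3) (Fin.cons c B)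
      - rowDet R (m + 3) (Fin.cons a (Fin.cons b (Fin.cons c A)))
          * rowDet R (m + 3) (Fin.cons d B) = 0 := by
  have h := sum_rowDet_succAbove_mul_rowDet_cons (m + 2)
    (Fin.cons a (Fin.cons b (Fin.cons c (Fin.cons d A)))) B
  rw [Fin.sum_univ_succ, Fin.sum_univ_succ, Fin.sum_univ_succ, Fin.sum_univ_succ,
    Finset.sum_eq_zero] at h
  · have e1 : (fun j => (Fin.cons a (Fin.cons b (Fin.cons c (Fin.cons d A))) :
        Fin (m + 4) → ℕ → R) ((0 : Fin (m + 4)).succAbove j))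
          = Fin.cons b (Fin.cons c (Fin.cons d A)) := by
      funext j; simp
    have e2 : (fun j => (Fin.cons a (Fin.cons b (Fin.cons c (Fin.cons d A))) :
        Fin (m + 4) → ℕ → R) ((0 : Fin (m + 3)).succ.succAbove j))
          = Fin.cons a (Fin.cons c (Fin.cons d A)) := by
      funext j
      refine Fin.cases ?_ (fun j => ?_) j <;>
        simp only [Fin.succ_succAbove_zero, Fin.succ_succAbove_succ, Fin.succAbove_zero,
          Fin.cons_zero, Fin.cons_succ]
    have e3 : (fun j => (Fin.cons a (Fin.cons b (Fin.cons c (Fin.cons d A))) :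
        Fin (m + 4) → ℕ → R) ((0 : Fin (m + 2)).succ.succ.succAbove j))
          = Fin.cons a (Fin.cons b (Fin.cons d A)) := by
      funext j
      refine Fin.cases ?_ (fun j => Fin.cases ?_ (fun j => ?_) j) j <;>
        simp only [Fin.succ_succAbove_zero, Fin.succ_succAbove_succ, Fin.succAbove_zero,
          Fin.cons_zero, Fin.cons_succ]
    have e4 : (fun j => (Fin.cons a (Fin.cons b (Fin.cons c (Fin.cons d A))) :
        Fin (m + 4) → ℕ → R) ((0 : Fin (m + 1)).succ.succ.succ.succAbove j))
          = Fin.cons a (Fin.cons b (Fin.cons c A)) := by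
      funext j
      refine Fin.cases ?_ (fun j => Fin.cases ?_ (fun j => Fin.cases ?_ (fun j => ?_) j) j) j <;>
        simp only [Fin.succ_succAbove_zero, Fin.succ_succAbove_succ, Fin.succAbove_zero,
          Fin.cons_zero, Fin.cons_succ]
    rw [e1, e2, e3, e4] at h
    simp only [Fin.cons_zero, Fin.cons_succ, Fin.val_succ, Fin.val_zero] at h
    linear_combination h
  · intro i _
    rw [Fin.cons_succ, Fin.cons_succ, Fin.cons_succ, Fin.cons_succ,
      rowDet_cons_eq_zero _ _ _ (hAB i), mul_zero]

end RowDet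

/-! ### Bilinear relations for bordered Toeplitz determinants. -/

section ToeplitzRelations

variable {R : Type*}

/-- The column `f k, f (k - 1), f (k - 2), …` of a bi-infinite sequence. -/
def seqCol (f : ℤ → R) (k : ℤ) : ℕ → R := fun i => f (k - i)

/-- The consecutive columns `g ν, …, g (ν + n - 1)`. -/
def seqCols (g : ℤ → R) (ν : ℤ) (n : ℕ) : Fin n → ℕ → R := fun j i => g (ν + (j : ℕ) - i)

theorem seqCols_succ (g : ℤ → R) (ν : ℤ) (n : ℕ) :
    seqCols g ν (n + 1) = Fin.cons (seqCol g ν) (seqCols g (ν + 1) n) := by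
  funext j i
  refine Fin.cases ?_ (fun j => ?_) j
  · simp [seqCols, seqCol]
  · simp only [seqCols, Fin.cons_succ, Fin.val_succ]
    congr 1
    push_cast
    ring

theorem seqCols_shift (g : ℤ → R) (ν : ℤ) (n : ℕ) :
    (fun j i => seqCols g ν n j (i + 1)) = seqCols g (ν - 1) n := by
  funext j i
  simp only [seqCols]
  congr 1
  push_cast
  ring

theorem cons_shift (n : ℕ) (p : ℕ → R) (U : Fin n → ℕ → R) :
    (fun j i => (Fin.cons p U : Fin (n + 1) → ℕ → R) j (i + 1))
      = Fin.cons (fun i => p (i + 1)) (fun j i => U j (i + 1)) := by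
  funext j i
  refine Fin.cases ?_ (fun j => ?_) j <;> simp

theorem seqCol_shift (f : ℤ → R) (k : ℤ) :
    (fun i => seqCol f k (i + 1)) = seqCol f (k - 1) := by
  funext i
  simp only [seqCol]
  congr 1
  push_cast
  ring

theorem seqCol_succ_shift (f : ℤ → R) (ν : ℤ) :
    (fun i => seqCol f (ν + 1) (i + 1)) = seqCol f ν := by
  rw [seqCol_shift, add_sub_cancel_right]

theorem exists_seqCols_eq_seqCol (g : ℤ → R) (ν : ℤ) (n : ℕ) {k : ℤ} (h₁ : ν ≤ k)
    (h₂ : k < ν + n) : ∃ j, seqCols g ν n j = seqCol g k := by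
  refine ⟨⟨(k - ν).toNat, by omega⟩, ?_⟩
  funext i
  simp only [seqCols, seqCol]
  congr 1
  omega

theorem exists_seqCols_eq_seqCols (g : ℤ → R) {ν μ : ℤ} {n m : ℕ} (h₁ : ν ≤ μ)
    (h₂ : μ + m ≤ ν + n) (i : Fin m) : ∃ j, seqCols g ν n j = seqCols g μ m i :=
  exists_seqCols_eq_seqCol g ν n (k := μ + (i : ℕ)) (by omega) (by omega)

variable [CommRing R]

/-- The Toeplitz determinant of a bi-infinite sequence. -/
noncomputable def toep (g : ℤ → R) (ν : ℤ) (n : ℕ) : R := rowDet R n (seqCols g ν n)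

/-- A Toeplitz determinant bordered by one column. -/
noncomputable def toepCons (p : ℕ → R) (g : ℤ → R) (ν : ℤ) (n : ℕ) : R :=
  rowDet R (n + 1) (Fin.cons p (seqCols g ν n))

/-- A Toeplitz determinant bordered by two columns. -/
noncomputable def toepConsCons (p r : ℕ → R) (g : ℤ → R) (ν : ℤ) (n : ℕ) : R :=
  rowDet R (n + 2) (Fin.cons p (Fin.cons r (seqCols g ν n)))

theorem toep_zero (g : ℤ → R) (ν : ℤ) : toep g ν 0 = 1 := by simp [toep, rowDet_apply]

theorem toep_one (g : ℤ → R) (ν : ℤ) : toep g ν 1 = g ν := by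
  simp [toep, rowDet_apply, seqCols]

theorem toep_two (g : ℤ → R) (ν : ℤ) : toep g ν 2 = g ν * g ν - g (ν - 1) * g (ν + 1) := by
  simp [toep, rowDet_apply, seqCols, Matrix.det_fin_two]

theorem toepCons_zero (p : ℕ → R) (g : ℤ → R) (ν : ℤ) : toepCons p g ν 0 = p 0 := by
  simp [toepCons, rowDet_apply]

theorem toepCons_seqCol (g : ℤ → R) (ν : ℤ) (n : ℕ) :
    toepCons (seqCol g ν) g (ν + 1) n = toep g ν (n + 1) := by
  rw [toep, toepCons, seqCols_succ]

theorem toepCons_add (p r : ℕ → R) (g : ℤ → R) (ν : ℤ) (n : ℕ) :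
    toepCons (p + r) g ν n = toepCons p g ν n + toepCons r g ν n :=
  rowDet_cons_add _ _ _ _

theorem toepCons_smul (a : R) (p : ℕ → R) (g : ℤ → R) (ν : ℤ) (n : ℕ) :
    toepCons (a • p) g ν n = a * toepCons p g ν n :=
  rowDet_cons_smul _ _ _ _

theorem toepCons_seqCol_eq_zero (g : ℤ → R) (ν : ℤ) (n : ℕ) :
    toepCons (seqCol g ν) g ν (n + 1) = 0 :=
  rowDet_cons_eq_zero _ _ _ (exists_seqCols_eq_seqCol g ν (n + 1) le_rfl (by omega))

theorem toepConsCons_swap (p r : ℕ → R) (g : ℤ → R) (ν : ℤ) (n : ℕ) :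
    toepConsCons p r g ν n = -toepConsCons r p g ν n :=
  rowDet_cons_cons_swap _ _ _ _

theorem toepConsCons_add_left (p p' r : ℕ → R) (g : ℤ → R) (ν : ℤ) (n : ℕ) :
    toepConsCons (p + p') r g ν n = toepConsCons p r g ν n + toepConsCons p' r g ν n :=
  rowDet_cons_add _ _ _ _

theorem toepConsCons_smul_left (a : R) (p r : ℕ → R) (g : ℤ → R) (ν : ℤ) (n : ℕ) :
    toepConsCons (a • p) r g ν n = a * toepConsCons p r g ν n :=
  rowDet_cons_smul _ _ _ _

theorem toepConsCons_add_right (p r r' : ℕ → R) (g : ℤ → R) (ν : ℤ) (n : ℕ) :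
    toepConsCons p (r + r') g ν n = toepConsCons p r g ν n + toepConsCons p r' g ν n := by
  rw [toepConsCons_swap, toepConsCons_add_left, toepConsCons_swap p r, toepConsCons_swap p r']
  ring

theorem toepConsCons_smul_right (a : R) (p r : ℕ → R) (g : ℤ → R) (ν : ℤ) (n : ℕ) :
    toepConsCons p (a • r) g ν n = a * toepConsCons p r g ν n := by
  rw [toepConsCons_swap, toepConsCons_smul_left, toepConsCons_swap p r]
  ring

theorem toepConsCons_self (p : ℕ → R) (g : ℤ → R) (ν : ℤ) (n : ℕ) :
    toepConsCons p p g ν n = 0 :=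
  rowDet_cons_eq_zero _ _ _ ⟨0, rfl⟩

theorem toepConsCons_seqCol_eq_zero (r : ℕ → R) (g : ℤ → R) (ν : ℤ) (n : ℕ) :
    toepConsCons (seqCol g ν) r g ν (n + 1) = 0 := by
  refine rowDet_cons_eq_zero _ _ _ ?_
  obtain ⟨j, hj⟩ := exists_seqCols_eq_seqCol g ν (n + 1) le_rfl (by omega)
  exact ⟨j.succ, by simpa using hj⟩

theorem rowDet_first_seqCols (g : ℤ → R) (ν : ℤ) (n : ℕ) :
    rowDet R (n + 1) (Fin.cons (Pi.single 0 1) (seqCols g ν n)) = toep g (ν - 1) n := by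
  rw [rowDet_cons_single_zero, seqCols_shift, toep]

theorem rowDet_cons_first_seqCols (p : ℕ → R) (g : ℤ → R) (ν : ℤ) (n : ℕ) :
    rowDet R (n + 2) (Fin.cons p (Fin.cons (Pi.single 0 1) (seqCols g ν n)))
      = -toepCons (fun i => p (i + 1)) g (ν - 1) n := by
  rw [rowDet_cons_cons_swap, rowDet_cons_single_zero, cons_shift, seqCols_shift, toepCons]

theorem rowDet_last_seqCols (g : ℤ → R) (ν : ℤ) (n : ℕ) :
    rowDet R (n + 1) (Fin.cons (Pi.single n 1) (seqCols g ν n)) = (-1) ^ n * toep g ν n := by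
  rw [rowDet_cons_single_last, toep]

theorem rowDet_cons_last_seqCols (p : ℕ → R) (g : ℤ → R) (ν : ℤ) (n : ℕ) :
    rowDet R (n + 2) (Fin.cons p (Fin.cons (Pi.single (n + 1) 1) (seqCols g ν n)))
      = (-1) ^ n * toepCons p g ν n := by
  rw [rowDet_cons_cons_swap, rowDet_cons_single_last, toepCons]
  ring

theorem rowDet_seqCol_cons (p : ℕ → R) (g : ℤ → R) (ν : ℤ) (n : ℕ) :
    rowDet R (n + 2) (Fin.cons p (Fin.cons (seqCol g ν) (seqCols g (ν + 1) n)))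
      = toepCons p g ν (n + 1) := by
  rw [toepCons, seqCols_succ]

theorem neg_one_pow_mul_cancel (n : ℕ) {a b : R} (h : (-1) ^ n * a = (-1) ^ n * b) : a = b := by
  have := congrArg ((-1) ^ n * ·) h
  simpa only [← mul_assoc, ← mul_pow, neg_mul_neg, one_mul, one_pow] using this

/-- Here and below, `first` and `last` say which basis vector enters the exchange. The first one
strikes out the top coordinate, lowering every index by one; the last one strikes out the bottom
coordinate, which only shrinks the size. -/
theorem toepCons_bilinear_first (p : ℕ → R) (g : ℤ → R) (ν : ℤ) (m : ℕ) :
    toepCons p g (ν + 1) (m + 1) * toep g (ν - 1) (m + 1)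
      = toepCons p g ν (m + 1) * toep g ν (m + 1)
        + toepCons (fun i => p (i + 1)) g ν m * toep g ν (m + 2) := by
  have h := rowDet_exchange_three m p (seqCol g ν) (Pi.single 0 1) (seqCols g (ν + 1) m)
    (seqCols g (ν + 1) (m + 1)) (exists_seqCols_eq_seqCols g le_rfl (by push_cast; omega))
  rw [rowDet_seqCol_cons, rowDet_cons_first_seqCols, rowDet_cons_first_seqCols, seqCol_shift,
    rowDet_first_seqCols, ← toepCons, ← toepCons, toepCons_seqCol, add_sub_cancel_right] at h
  have e := toepCons_seqCol g (ν - 1) m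
  rw [sub_add_cancel] at e
  rw [e] at h
  linear_combination -h

theorem toepCons_bilinear_last (p : ℕ → R) (g : ℤ → R) (ν : ℤ) (m : ℕ) :
    toepCons p g (ν + 1) (m + 1) * toep g ν (m + 1)
      = toepCons p g ν (m + 1) * toep g (ν + 1) (m + 1)
        + toepCons p g (ν + 1) m * toep g ν (m + 2) := by
  have h := rowDet_exchange_three m p (seqCol g ν) (Pi.single (m + 1) 1) (seqCols g (ν + 1) m)
    (seqCols g (ν + 1) (m + 1)) (exists_seqCols_eq_seqCols g le_rfl (by push_cast; omega))
  rw [rowDet_seqCol_cons, rowDet_cons_last_seqCols, rowDet_cons_last_seqCols,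
    rowDet_last_seqCols, ← toepCons, ← toepCons, toepCons_seqCol, toepCons_seqCol] at h
  apply neg_one_pow_mul_cancel m
  linear_combination h

theorem rowDet_first_last_seqCols (g : ℤ → R) (ν : ℤ) (n : ℕ) :
    rowDet R (n + 2) (Fin.cons (Pi.single 0 1) (Fin.cons (Pi.single (n + 1) 1) (seqCols g ν n)))
      = (-1) ^ n * toep g (ν - 1) n := by
  have e : (fun i => (Pi.single (n + 1) 1 : ℕ → R) (i + 1)) = Pi.single n 1 := by
    funext i
    simp [Pi.single_apply]
  rw [rowDet_cons_single_zero, cons_shift, seqCols_shift, e, rowDet_last_seqCols]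

theorem toepCons_bilinear_first_last (p : ℕ → R) (g : ℤ → R) (ν : ℤ) (m : ℕ) :
    toepCons p g (ν + 1) (m + 1) * toep g ν m
      = toepCons p g (ν + 1) m * toep g ν (m + 1)
        - toepCons (fun i => p (i + 1)) g ν m * toep g (ν + 1) (m + 1) := by
  have h := rowDet_exchange_three m p (Pi.single 0 1) (Pi.single (m + 1) 1) (seqCols g (ν + 1) m)
    (seqCols g (ν + 1) (m + 1)) (exists_seqCols_eq_seqCols g le_rfl (by push_cast; omega))
  rw [rowDet_first_last_seqCols, rowDet_cons_last_seqCols, rowDet_cons_first_seqCols,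
    rowDet_first_seqCols, rowDet_last_seqCols, ← toepCons, add_sub_cancel_right] at h
  apply neg_one_pow_mul_cancel m
  linear_combination h

theorem toepConsCons_bilinear_last (p r : ℕ → R) (g : ℤ → R) (ν : ℤ) (m : ℕ) :
    toepConsCons p r g ν m * toep g ν (m + 1)
      = toepCons p g ν (m + 1) * toepCons r g ν m
        - toepCons p g ν m * toepCons r g ν (m + 1) := by
  have h := rowDet_exchange_three m p r (Pi.single (m + 1) 1) (seqCols g ν m)
    (seqCols g ν (m + 1)) (exists_seqCols_eq_seqCols g le_rfl (by push_cast; omega))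
  rw [rowDet_cons_last_seqCols, rowDet_cons_last_seqCols, rowDet_last_seqCols, ← toepCons,
    ← toepCons, ← toepConsCons] at h
  apply neg_one_pow_mul_cancel m
  linear_combination -h

theorem toepConsCons_bilinear_first (p r : ℕ → R) (g : ℤ → R) (ν : ℤ) (m : ℕ) :
    toepConsCons p r g (ν + 1) m * toep g ν (m + 1)
      = toepCons p g (ν + 1) (m + 1) * toepCons (fun i => r (i + 1)) g ν m
        - toepCons (fun i => p (i + 1)) g ν m * toepCons r g (ν + 1) (m + 1) := by
  have h := rowDet_exchange_three m p r (Pi.single 0 1) (seqCols g (ν + 1) m)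
    (seqCols g (ν + 1) (m + 1)) (exists_seqCols_eq_seqCols g le_rfl (by push_cast; omega))
  rw [rowDet_cons_first_seqCols, rowDet_cons_first_seqCols, rowDet_first_seqCols, ← toepCons,
    ← toepCons, ← toepConsCons, add_sub_cancel_right] at h
  linear_combination h

theorem toepConsCons_bilinear_first_succ (p r : ℕ → R) (g : ℤ → R) (ν : ℤ) (m : ℕ) :
    toepConsCons p r g (ν + 1) m * toep g (ν - 1) (m + 1)
      = toepCons p g ν (m + 1) * toepCons (fun i => r (i + 1)) g ν m
        - toepCons (fun i => p (i + 1)) g ν m * toepCons r g ν (m + 1) := by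
  have h := rowDet_exchange_three m p r (Pi.single 0 1) (seqCols g (ν + 1) m)
    (seqCols g ν (m + 1)) (exists_seqCols_eq_seqCols g (by omega) (by push_cast; omega))
  rw [rowDet_cons_first_seqCols, rowDet_cons_first_seqCols, rowDet_first_seqCols, ← toepCons,
    ← toepCons, ← toepConsCons, add_sub_cancel_right] at h
  linear_combination h

theorem toepConsCons_bilinear_first_last (p r : ℕ → R) (g : ℤ → R) (ν : ℤ) (m : ℕ) :
    toepConsCons p r g (ν + 1) m * toep g ν m
      = toepCons p g (ν + 1) m * toepCons (fun i => r (i + 1)) g ν m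
        - toepCons (fun i => p (i + 1)) g ν m * toepCons r g (ν + 1) m := by
  have h := rowDet_exchange_three m p r (Pi.single 0 1) (seqCols g (ν + 1) m)
    (Fin.cons (Pi.single (m + 1) 1) (seqCols g (ν + 1) m)) (fun i => ⟨i.succ, by simp⟩)
  rw [rowDet_cons_first_seqCols, rowDet_cons_first_seqCols, rowDet_first_last_seqCols,
    rowDet_cons_last_seqCols, rowDet_cons_last_seqCols, ← toepConsCons,
    add_sub_cancel_right] at h
  apply neg_one_pow_mul_cancel m
  linear_combination h

theorem toepConsCons_bilinear_succ (p r : ℕ → R) (g : ℤ → R) (ν : ℤ) (m : ℕ) :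
    toepConsCons p r g (ν + 1) m * toep g ν (m + 2)
      = toepCons p g ν (m + 1) * toepCons r g (ν + 1) (m + 1)
        - toepCons p g (ν + 1) (m + 1) * toepCons r g ν (m + 1) := by
  have h := rowDet_exchange_three m p r (seqCol g ν) (seqCols g (ν + 1) m)
    (seqCols g (ν + 1) (m + 1)) (exists_seqCols_eq_seqCols g le_rfl (by push_cast; omega))
  rw [rowDet_seqCol_cons, rowDet_seqCol_cons, ← toepCons,
    ← toepCons, ← toepConsCons, ← toepCons, toepCons_seqCol] at h
  linear_combination h

/-- Here the family `B` has two more vectors than `A`, so four terms survive the exchange of the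
last basis vector, `p`, `r` and the column `g ν`. -/
theorem toepConsCons_bilinear_sub (p r : ℕ → R) (g : ℤ → R) (ν : ℤ) (m : ℕ) :
    toepConsCons p r g (ν + 1) m * toep g ν (m + 3)
        - toepConsCons p r g ν (m + 1) * toep g (ν + 1) (m + 2)
      = toepCons p g ν (m + 1) * toepCons r g (ν + 1) (m + 2)
        - toepCons r g ν (m + 1) * toepCons p g (ν + 1) (m + 2) := by
  have h := rowDet_exchange_four m (Pi.single (m + 2) 1) p r (seqCol g ν) (seqCols g (ν + 1) m)
    (seqCols g (ν + 1) (m + 2)) (exists_seqCols_eq_seqCols g le_rfl (by push_cast; omega))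
  rw [← seqCols_succ] at h
  simp only [rowDet_cons_single_last] at h
  apply neg_one_pow_mul_cancel (m + 2)
  rw [← toepCons_seqCol g ν (m + 2)]
  simp only [toep, toepCons, toepConsCons]
  linear_combination -h

end ToeplitzRelations

/-! ### Column elimination for first-order recursions. -/

section Elimination

variable {R : Type*} [CommRing R]

/-- Column elimination: if `f (k + 1) = s * f k + g k`, then the Toeplitz determinant of `f` is
that of `g` bordered by one column of `f`. -/
theorem toepCons_eq_toep {f g : ℤ → R} {s : R} (h : ∀ k, f (k + 1) = s * f k + g k) (ν : ℤ)
    (n : ℕ) : toepCons (seqCol f ν) g ν n = toep f ν (n + 1) := by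
  rw [toep, toepCons, rowDet_apply, rowDet_apply]
  refine (Matrix.det_eq_of_forall_row_eq_smul_add_pred (fun _ => s) (fun j => ?_)
    (fun i j => ?_)).symm
  · simp [seqCols, seqCol]
  · simp only [Matrix.of_apply, seqCols, Fin.cons_succ, Fin.val_succ, Fin.val_castSucc]
    rw [← add_comm (s * _), ← h]
    congr 1
    push_cast
    ring

theorem toepConsCons_eq_toep {x y g : ℤ → R} {u s : R} (hx : ∀ k, x (k + 1) = u * x k + y k)
    (hy : ∀ k, y (k + 1) = s * y k + g k) (ν : ℤ) (n : ℕ) :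
    toepConsCons (seqCol x ν) (seqCol y ν) g ν n = toep x ν (n + 2) := by
  rw [← toepCons_eq_toep hx, toepCons, toepConsCons, rowDet_apply, rowDet_apply]
  -- The coefficient `0` leaves the first `y` column intact; elimination starts with the second.
  refine (Matrix.det_eq_of_forall_row_eq_smul_add_pred (Fin.cons 0 fun _ => s) (fun j => ?_)
    (fun i j => ?_)).symm
  · simp
  · refine Fin.cases ?_ (fun i => ?_) i
    · simp [seqCols, seqCol]
    · simp only [Matrix.of_apply, seqCols, Fin.cons_succ, Fin.val_succ, Fin.castSucc_succ,
        Fin.val_castSucc]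
      rw [← add_comm (s * _), ← hy]
      congr 1
      push_cast
      ring

theorem seqCol_succ {f g : ℤ → R} {s : R} (h : ∀ k, f (k + 1) = s * f k + g k) (ν : ℤ) :
    seqCol f (ν + 1) = s • seqCol f ν + seqCol g ν := by
  funext i
  simp only [seqCol, Pi.add_apply, Pi.smul_apply, smul_eq_mul, ← h]
  congr 1
  ring

/-- The `g ν` part of the border already occurs among the columns, so only `s` times the column of
`f` at `ν` contributes. -/
theorem toepCons_seqCol_succ {f g : ℤ → R} {s : R} (h : ∀ k, f (k + 1) = s * f k + g k) (ν : ℤ)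
    (n : ℕ) : toepCons (seqCol f (ν + 1)) g ν (n + 1) = s * toep f ν (n + 2) := by
  rw [seqCol_succ h, toepCons_add, toepCons_smul, toepCons_seqCol_eq_zero, toepCons_eq_toep h,
    add_zero]

theorem toep_bilinear_first {f g : ℤ → R} {s : R} (h : ∀ k, f (k + 1) = s * f k + g k) (ν : ℤ)
    (N : ℕ) :
    toep f (ν + 1) (N + 1) * toep g (ν - 1) N
      = s * toep f ν (N + 1) * toep g ν N + toep f ν N * toep g ν (N + 1) := by
  cases N with
  | zero =>
    simp only [zero_add, toep_zero, toep_one, h]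
    ring
  | succ m =>
    have := toepCons_bilinear_first (seqCol f (ν + 1)) g ν m
    rw [toepCons_seqCol_succ h, seqCol_succ_shift, toepCons_eq_toep h, toepCons_eq_toep h] at this
    exact this

theorem toep_bilinear_last {f g : ℤ → R} {s : R} (h : ∀ k, f (k + 1) = s * f k + g k) (ν : ℤ)
    (N : ℕ) :
    toep f (ν + 1) (N + 1) * toep g ν N
      = s * toep f ν (N + 1) * toep g (ν + 1) N + toep f (ν + 1) N * toep g ν (N + 1) := by
  cases N with
  | zero =>
    simp only [zero_add, toep_zero, toep_one, h]
    ring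
  | succ m =>
    have := toepCons_bilinear_last (seqCol f (ν + 1)) g ν m
    rw [toepCons_seqCol_succ h, toepCons_eq_toep h, toepCons_eq_toep h] at this
    exact this

theorem toep_bilinear_first_last {f g : ℤ → R} {s : R} (h : ∀ k, f (k + 1) = s * f k + g k)
    (ν : ℤ) (m : ℕ) :
    toep f (ν + 1) (m + 2) * toep g ν m
      = toep f (ν + 1) (m + 1) * toep g ν (m + 1)
        - toep f ν (m + 1) * toep g (ν + 1) (m + 1) := by
  have := toepCons_bilinear_first_last (seqCol f (ν + 1)) g ν m
  rwa [seqCol_succ_shift, toepCons_eq_toep h, toepCons_eq_toep h, toepCons_eq_toep h] at this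

end Elimination

/-! ### Relations among the three coupled sequences. -/

section SecondOrder

variable {R : Type*} [CommRing R] {x y g ζ : ℤ → R} {u : R}

theorem seqCol_difference (hζ : ∀ k, x (k + 1) = x k + ζ k) (ν : ℤ) :
    seqCol x (ν + 1) = seqCol x ν + seqCol ζ ν := by
  rw [seqCol_succ (s := 1) (g := ζ) (by simpa using hζ), one_smul]

theorem difference_succ (hx : ∀ k, x (k + 1) = u * x k + y k) (hy : ∀ k, y (k + 1) = y k + g k)
    (hζ : ∀ k, x (k + 1) = x k + ζ k) (k : ℤ) : ζ (k + 1) = u * ζ k + g k := by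
  linear_combination hx (k + 1) - hx k + hy k - hζ (k + 1) + u * hζ k

/-- Since `ζ = (u - 1) x + y`, the border `ζ, x` is equivalent to `y, x`, a transposition of `x, y`.
-/
theorem toepConsCons_difference (hx : ∀ k, x (k + 1) = u * x k + y k)
    (hy : ∀ k, y (k + 1) = y k + g k) (hζ : ∀ k, x (k + 1) = x k + ζ k) (ν : ℤ) (n : ℕ) :
    toepConsCons (seqCol ζ ν) (seqCol x ν) g ν n = -toep x ν (n + 2) := by
  have e : seqCol ζ ν = (u - 1) • seqCol x ν + seqCol y ν := by
    funext i
    simp only [seqCol, Pi.add_apply, Pi.smul_apply, smul_eq_mul]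
    linear_combination hx (ν - i) - hζ (ν - i)
  rw [e, toepConsCons_add_left, toepConsCons_smul_left, toepConsCons_self, toepConsCons_swap,
    toepConsCons_eq_toep hx (s := 1) (by simpa using hy)]
  ring

theorem toep_bilinear_shift_both (hu : IsUnit u) (hx : ∀ k, x (k + 1) = u * x k + y k)
    (hy : ∀ k, y (k + 1) = y k + g k) (hζ : ∀ k, x (k + 1) = x k + ζ k) (ν : ℤ) (N : ℕ) :
    toep x ν (N + 1) * toep g ν N - toep x (ν + 1) (N + 1) * toep g (ν - 1) N
      = -(toep ζ ν (N + 1) * toep y ν N) := by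
  have hz := difference_succ hx hy hζ
  have hy₁ : ∀ k, y (k + 1) = 1 * y k + g k := by simpa using hy
  cases N with
  | zero =>
    simp only [zero_add, toep_zero, toep_one, hζ]
    ring
  | succ m =>
    have hP := toepConsCons_bilinear_last (seqCol ζ ν) (seqCol x ν) g ν m
    rw [toepConsCons_difference hx hy hζ, toepCons_eq_toep hz, toepCons_eq_toep hz] at hP
    -- The choice `x - y` works because `x (k+1) - y (k+1) = u x k - g k`: bordering `g` with it
    -- produces `u` times the mixed determinant already in `hP`.
    have hQ := toepConsCons_bilinear_first_succ (seqCol ζ (ν + 1))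
      (seqCol x (ν + 1) + (-1 : R) • seqCol y (ν + 1)) g ν m
    have e₁ : (fun i => (seqCol x (ν + 1) + (-1 : R) • seqCol y (ν + 1)) (i + 1))
        = seqCol x ν + (-1 : R) • seqCol y ν := by
      rw [← seqCol_succ_shift x ν, ← seqCol_succ_shift y ν]
      rfl
    have e₂ : toepCons (seqCol x (ν + 1) + (-1 : R) • seqCol y (ν + 1)) g ν (m + 1)
        = u * toepCons (seqCol x ν) g ν (m + 1) := by
      rw [seqCol_succ hx, toepCons_add, toepCons_add, toepCons_smul, toepCons_smul,
        toepCons_seqCol_succ hy₁, toepCons_eq_toep hy₁]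
      ring
    have e₃ : toepConsCons (seqCol ζ (ν + 1)) (seqCol x (ν + 1) + (-1 : R) • seqCol y (ν + 1))
        g (ν + 1) m = -(u * toep x (ν + 1) (m + 2)) := by
      have e : seqCol y (ν + 1) = (1 - u) • seqCol x (ν + 1) + seqCol ζ (ν + 1) := by
        funext i
        simp only [seqCol, Pi.add_apply, Pi.smul_apply, smul_eq_mul]
        linear_combination hζ (ν + 1 - i) - hx (ν + 1 - i)
      rw [e]
      simp only [toepConsCons_add_right, toepConsCons_smul_right, toepConsCons_self,
        toepConsCons_difference hx hy hζ]
      ring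
    rw [e₁, e₂, e₃, toepCons_seqCol_succ hz, seqCol_succ_shift, toepCons_eq_toep hz, toepCons_add,
      toepCons_smul, toepCons_eq_toep hy₁] at hQ
    -- In `hQ - u * hP` the mixed determinants cancel, leaving `u` times the claim; hence `u` must
    -- be cancellable.
    apply hu.mul_left_cancel
    linear_combination hQ - u * hP

theorem toep_bilinear_succ_size (hx : ∀ k, x (k + 1) = u * x k + y k)
    (hy : ∀ k, y (k + 1) = y k + g k) (hζ : ∀ k, x (k + 1) = x k + ζ k) (ν : ℤ) (m : ℕ) :
    toep x (ν + 1) (m + 1) * toep g ν (m + 1) + u * toep x (ν + 1) (m + 2) * toep g ν m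
      = toep ζ (ν + 1) (m + 1) * toep y ν (m + 1) := by
  have hz := difference_succ hx hy hζ
  have hy₁ : ∀ k, y (k + 1) = 1 * y k + g k := by simpa using hy
  have hU := toepConsCons_bilinear_first_last (seqCol ζ (ν + 1)) (seqCol x (ν + 1)) g ν m
  rw [toepConsCons_difference hx hy hζ, toepCons_eq_toep hz, seqCol_succ_shift, seqCol_succ_shift,
    toepCons_eq_toep hz] at hU
  have e : toepCons (seqCol x (ν + 1)) g ν m
      = u * toepCons (seqCol x ν) g ν m + toep y ν (m + 1) := by
    rw [seqCol_succ hx, toepCons_add, toepCons_smul, toepCons_eq_toep hy₁]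
  -- After `e` is inserted, `hU` and `hV` contain the same two mixed determinants, which cancel in
  -- `hV + u * hU`.
  have hV : -(toep x (ν + 1) (m + 1) * toep g ν (m + 1))
      = u * toep ζ ν (m + 1) * toepCons (seqCol x (ν + 1)) g (ν + 1) m
        - toep ζ (ν + 1) (m + 1) * toepCons (seqCol x (ν + 1)) g ν m := by
    cases m with
    | zero =>
      simp only [zero_add, toep_one, toepCons_zero, seqCol, hz]
      simp
      ring
    | succ m =>
      have := toepConsCons_bilinear_succ (seqCol ζ (ν + 1)) (seqCol x (ν + 1)) g ν m
      rw [toepConsCons_difference hx hy hζ, toepCons_seqCol_succ hz, toepCons_eq_toep hz] at this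
      linear_combination this
  rw [e] at hV
  linear_combination -hV - u * hU

theorem toep_bilinear_succ_succ (hx : ∀ k, x (k + 1) = u * x k + y k)
    (hy : ∀ k, y (k + 1) = y k + g k) (hζ : ∀ k, x (k + 1) = x k + ζ k) (ν : ℤ) (N : ℕ) :
    toep x (ν + 1) N * toep g ν (N + 1) - u * toep x ν (N + 1) * toep g (ν + 1) N
        + toep x (ν + 1) (N + 1) * toep g ν N
      = toep ζ ν N * toep y (ν + 1) (N + 1) := by
  have hz := difference_succ hx hy hζ
  have hy₁ : ∀ k, y (k + 1) = 1 * y k + g k := by simpa using hy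
  cases N with
  | zero =>
    simp only [zero_add, toep_zero, toep_one, hx, hy]
    ring
  | succ m =>
    have hR := toepConsCons_bilinear_first (seqCol ζ (ν + 1)) (seqCol x (ν + 1 + 1)) g ν m
    have e₁ : toepConsCons (seqCol ζ (ν + 1)) (seqCol x (ν + 1 + 1)) g (ν + 1) m
        = -toep x (ν + 1) (m + 2) := by
      rw [seqCol_difference hζ, toepConsCons_add_right, toepConsCons_self,
        toepConsCons_difference hx hy hζ, add_zero]
    have e₂ : toepCons (seqCol x (ν + 1 + 1)) g (ν + 1) (m + 1)
        = u * toepCons (seqCol x (ν + 1)) g (ν + 1) (m + 1) + toep y (ν + 1) (m + 2) := by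
      rw [seqCol_succ hx, toepCons_add, toepCons_smul, toepCons_eq_toep hy₁]
    rw [e₁, e₂, toepCons_eq_toep hz, seqCol_succ_shift, seqCol_succ_shift,
      toepCons_eq_toep hz] at hR
    -- The mixed products here are opposite to those in `hR`. The four-term exchange needs size at
    -- least three, so `m = 0` is checked by writing everything in terms of `x` and `g`.
    have hS : -(toep x (ν + 1) (m + 1) * toep g ν (m + 2))
          + u * toep x ν (m + 2) * toep g (ν + 1) (m + 1)
        = u * toep ζ ν (m + 1) * toepCons (seqCol x (ν + 1)) g (ν + 1) (m + 1)
          - toepCons (seqCol x (ν + 1)) g ν m * toep ζ (ν + 1) (m + 2) := by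
      cases m with
      | zero =>
        have e₃ : toepCons (seqCol x (ν + 1)) g (ν + 1) 1
            = x (ν + 1) * g ν - x ν * g (ν + 1) := by
          simp [toepCons, rowDet_apply, Matrix.det_fin_two, seqCol, seqCols]
        simp only [zero_add, toep_one, toep_two, toepCons_zero, e₃, seqCol]
        have h₁ := hx (ν - 1)
        have h₂ := hy (ν - 1)
        rw [sub_add_cancel] at h₁ h₂
        have h₃ : g (ν - 1) = x (ν + 1) - u * x ν - (x ν - u * x (ν - 1)) := by
          linear_combination h₁ - h₂ - hx ν
        have h₄ : ζ ν = x (ν + 1) - x ν := by linear_combination -hζ ν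
        simp only [add_sub_cancel_right, Nat.cast_zero, sub_zero]
        rw [hz (ν + 1), hz ν, h₃, h₄]
        ring
      | succ m =>
        have := toepConsCons_bilinear_sub (seqCol ζ (ν + 1)) (seqCol x (ν + 1)) g ν m
        have e₄ : toepConsCons (seqCol ζ (ν + 1)) (seqCol x (ν + 1)) g ν (m + 1)
            = -(u * toep x ν (m + 3)) := by
          rw [seqCol_succ hz, toepConsCons_add_left, toepConsCons_smul_left,
            toepConsCons_seqCol_eq_zero, seqCol_difference hζ, toepConsCons_add_right,
            toepConsCons_self, toepConsCons_difference hx hy hζ]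
          ring
        rw [e₄, toepConsCons_difference hx hy hζ, toepCons_seqCol_succ hz,
          toepCons_eq_toep hz] at this
        linear_combination this
    linear_combination -hR - hS

end SecondOrder

/-! ### Geometric rescaling and the eight equations. -/

theorem toeplitzPhi_eq_toep (G : ℤ → ℂ → ℂ) (N : ℕ) (ν : ℤ) (c : ℂ) :
    toeplitzPhi G N ν c = toep (fun k => G k c) ν N := by
  rw [toeplitzPhi, toep, rowDet_apply, ← Matrix.det_transpose]
  congr 1
  ext j i
  simp only [Matrix.transpose_apply, Matrix.of_apply, seqCols]
  congr 1
  ring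

/-- Rescaling by a geometric sequence rescales Toeplitz determinants. -/
theorem toep_geometric {K : Type*} [Field K] {q : K} (hq : q ≠ 0) (b : K) (f : ℤ → K) (ν : ℤ)
    (n : ℕ) :
    toep (fun k => b * q ^ (2 * k) * f k) ν n = (b * q ^ (2 * ν)) ^ n * toep f ν n := by
  rw [toep, toep, rowDet_apply, rowDet_apply]
  have e : (Matrix.of fun j i : Fin n => seqCols (fun k => b * q ^ (2 * k) * f k) ν n j i)
      = (b * q ^ (2 * ν)) • Matrix.of fun j i : Fin n => q ^ (2 * ((j : ℕ) : ℤ)) *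
          (Matrix.of fun j i : Fin n => q ^ (-2 * ((i : ℕ) : ℤ)) *
            (Matrix.of fun j i : Fin n => seqCols f ν n j i) j i) j i := by
    ext j i
    -- The factor splits into a constant, a row factor and a column factor; the last two have
    -- inverse products.
    have h : 2 * (ν + (j : ℕ) - (i : ℕ)) = 2 * ν + 2 * ((j : ℕ) : ℤ) + -2 * ((i : ℕ) : ℤ) := by
      ring
    simp only [Matrix.smul_apply, Matrix.of_apply, seqCols, smul_eq_mul, h, zpow_add₀ hq]
    ring
  have h : (∏ j : Fin n, q ^ (2 * ((j : ℕ) : ℤ))) * ∏ i : Fin n, q ^ (-2 * ((i : ℕ) : ℤ)) = 1 := by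
    rw [← Finset.prod_mul_distrib]
    refine Finset.prod_eq_one fun j _ => ?_
    rw [← zpow_add₀ hq, neg_mul, add_neg_cancel, zpow_zero]
  rw [e, Matrix.det_smul, Fintype.card_fin, Matrix.det_mul_column, Matrix.det_mul_row,
    ← mul_assoc (∏ j : Fin n, _), h, one_mul]

theorem mainTheorem2 (q a₀ : ℂ) (hq : q ≠ 0) (ha₀ : a₀ ≠ 0)
    (D : Set ℂ) (hD0 : (0 : ℂ) ∉ D) (hD : ∀ c : ℂ, q * c ∈ D ↔ c ∈ D)
    (G : ℤ → ℂ → ℂ) (hG : SatisfiesContiguity q a₀ D G)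
    (φ : ℕ → ℤ → ℂ → ℂ) (hφ : φ = toeplitzPhi G)
    (N : ℕ) (ν : ℤ) (c : ℂ) (hc : c ∈ D) :
    (a₀ ^ 2 * c ^ 2 * q ^ (2 * ν) * φ N ν (q * c) * φ (N + 1) ν c
        + φ N ν c * φ (N + 1) ν (q * c)
      = q ^ (-2 * (N : ℤ)) * φ (N + 1) (ν + 1) (q * c) * φ N (ν - 1) c) ∧
    (a₀ ^ 2 * q ^ (2 * ν) * φ N ν (q * c) * φ (N + 1) (ν + 1) c
        - φ N ν c * φ (N + 1) (ν + 1) (q * c)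
      = (a₀ ^ 2 * q ^ (2 * ν) - q ^ (2 * N)) * φ (N + 1) ν (q * c) * φ N (ν + 1) c) ∧
    (φ (N + 1) (ν + 1) (q * c) * φ N ν c
        - q ^ (2 * N) * φ (N + 1) (ν + 1) c * φ N ν (q * c)
      = c ^ 2 * (a₀ ^ 2 * q ^ (2 * ν) - q ^ (2 * N)) * φ (N + 1) ν c * φ N (ν + 1) (q * c)) ∧
    (1 ≤ N →
      φ N (ν + 1) (q * c) * φ N ν c - φ N (ν + 1) c * φ N ν (q * c)
        = -(φ (N - 1) ν (q * c) * φ (N + 1) (ν + 1) c)) ∧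
    (1 ≤ N →
      φ N (ν + 1) (q * c) * φ N ν c - q ^ (2 * N) * φ N (ν + 1) c * φ N ν (q * c)
        = 1 / (a₀ ^ 2 * q ^ (2 * ν) * c ^ 2)
          * φ (N + 1) (ν + 1) (q * c) * φ (N - 1) ν c) ∧
    (q ^ (2 * N) * φ N ν c * φ (N + 1) ν c - φ (N + 1) (ν + 1) c * φ N (ν - 1) c
      = -(a₀ ^ 2 * c ^ 2 * q ^ (2 * (ν - 1)) * φ (N + 1) ν (q⁻¹ * c) * φ N ν (q * c))) ∧
    (φ N ν c * φ (N + 1) (ν + 1) c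
        + c ^ 2 * (a₀ ^ 2 * q ^ (2 * ν) - q ^ (2 * N)) * φ (N + 1) ν c * φ N (ν + 1) c
      = q ^ (-2 * (N : ℤ)) * φ N ν (q⁻¹ * c) * φ (N + 1) (ν + 1) (q * c)) ∧
    (1 ≤ N →
      a₀ ^ 2 * q ^ (2 * ν) * φ N ν c * φ N (ν + 1) c
          + φ (N + 1) (ν + 1) c * φ (N - 1) ν c
        = a₀ ^ 2 * q ^ (2 * ν) * φ N (ν + 1) (q⁻¹ * c) * φ N ν (q * c)) := by
  have hc0 : c ≠ 0 := fun h => hD0 (h ▸ hc)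
  have hcq : q⁻¹ * c ∈ D := (hD _).1 (by rwa [mul_inv_cancel_left₀ hq])
  -- the three sequences and their first-order relations
  obtain ⟨x, hxdef⟩ : ∃ x : ℤ → ℂ, x = fun k => G k c := ⟨_, rfl⟩
  obtain ⟨y, hydef⟩ : ∃ y : ℤ → ℂ, y = fun k => G k (q * c) := ⟨_, rfl⟩
  obtain ⟨z, hzdef⟩ : ∃ z : ℤ → ℂ, z = fun k => G k (q⁻¹ * c) := ⟨_, rfl⟩
  obtain ⟨g, hgdef⟩ : ∃ g : ℤ → ℂ, g = fun k => a₀ ^ 2 * c ^ 2 * q ^ (2 * k) * x k := ⟨_, rfl⟩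
  -- The factor `(q ^ 2)⁻¹` comes from the square of `q⁻¹ * c` in the contiguity relation taken at
  -- that point.
  obtain ⟨ζ, hζdef⟩ : ∃ ζ : ℤ → ℂ, ζ = fun k => a₀ ^ 2 * c ^ 2 * (q ^ 2)⁻¹ * q ^ (2 * k) * z k :=
    ⟨_, rfl⟩
  have hx : ∀ k, x (k + 1) = c ^ 2 * x k + y k := fun k => by
    simp only [hxdef, hydef]
    rw [hG.shift_c k c hc]
    ring
  have hy : ∀ k, y (k + 1) = y k + g k := fun k => by
    simp only [hgdef, hxdef, hydef]
    rw [hG.shift_qc k c hc]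
    ring
  have hζ : ∀ k, x (k + 1) = x k + ζ k := fun k => by
    have h := hG.shift_qc k (q⁻¹ * c) hcq
    rw [mul_inv_cancel_left₀ hq] at h
    simp only [hζdef, hxdef, hzdef]
    rw [h]
    field_simp
  have hy₁ : ∀ k, y (k + 1) = 1 * y k + g k := by simpa using hy
  -- Toeplitz determinants of the rescaled sequences
  obtain ⟨τ, hτ⟩ : ∃ τ : ℂ, τ = a₀ ^ 2 * c ^ 2 * q ^ (2 * ν) := ⟨_, rfl⟩
  have hτ0 : τ ≠ 0 := by rw [hτ]; positivity
  have hsucc : q ^ (2 * (ν + 1)) = q ^ (2 * ν) * q ^ 2 := by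
    rw [mul_add, zpow_add₀ hq]; rfl
  have hpred : q ^ (2 * (ν - 1)) = q ^ (2 * ν) * (q ^ 2)⁻¹ := by
    rw [mul_sub, zpow_sub₀ hq, div_eq_mul_inv]; rfl
  have hneg : q ^ (-2 * (N : ℤ)) = (q ^ (2 * N))⁻¹ := by
    rw [neg_mul, zpow_neg]; norm_cast
  have g₀ : ∀ n, toep g ν n = τ ^ n * toep x ν n := fun n => by
    rw [hgdef, toep_geometric hq, hτ]
  have g₁ : ∀ n, toep g (ν + 1) n = τ ^ n * q ^ (2 * n) * toep x (ν + 1) n := fun n => by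
    rw [hgdef, toep_geometric hq, hsucc, hτ, pow_mul, ← mul_pow]; ring_nf
  have g₂ : ∀ n, toep g (ν - 1) n = τ ^ n * (q ^ (2 * n))⁻¹ * toep x (ν - 1) n := fun n => by
    rw [hgdef, toep_geometric hq, hpred, hτ, pow_mul, ← inv_pow, ← mul_pow]; ring_nf
  have z₀ : ∀ n, toep ζ ν n = τ ^ n * (q ^ (2 * n))⁻¹ * toep z ν n := fun n => by
    rw [hζdef, toep_geometric hq, hτ, pow_mul, ← inv_pow, ← mul_pow]; ring_nf
  have z₁ : ∀ n, toep ζ (ν + 1) n = τ ^ n * toep z (ν + 1) n := fun n => by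
    rw [hζdef, toep_geometric hq, hsucc, hτ]
    congr 2
    field_simp
  have hτN : ∀ n, τ ^ n ≠ 0 := fun n => pow_ne_zero n hτ0
  have hxy := toep_bilinear_last hx ν N
  have hyx : toep y (ν + 1) (N + 1) * toep x ν N
      = q ^ (2 * N) * toep y ν (N + 1) * toep x (ν + 1) N
        + a₀ ^ 2 * c ^ 2 * q ^ (2 * ν) * toep y (ν + 1) N * toep x ν (N + 1) := by
    have h := toep_bilinear_last hy₁ ν N
    rw [g₀, g₀, g₁] at h
    rw [← hτ]
    apply mul_left_cancel₀ (hτN N)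
    linear_combination h
  subst hφ
  simp only [toeplitzPhi_eq_toep, hneg, hpred, ← hxdef, ← hydef, ← hzdef]
  refine ⟨?_, ?_, ?_, ?_, ?_, ?_, ?_, ?_⟩
  · have h := toep_bilinear_first hy₁ ν N
    rw [g₀, g₀, g₂] at h
    rw [← hτ]
    apply mul_left_cancel₀ (hτN N)
    linear_combination -h
  -- `hxy` and `hyx` share two products on their right-hand sides; this goal and the next each
  -- eliminate one of them.
  · linear_combination a₀ ^ 2 * q ^ (2 * ν) * hxy - hyx
  · linear_combination hyx - q ^ (2 * N) * hxy
  · intro hN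
    obtain ⟨m, rfl⟩ := Nat.exists_eq_add_of_le' hN
    rw [Nat.add_sub_cancel]
    linear_combination toep_bilinear_first_last hx ν m
  · intro hN
    obtain ⟨m, rfl⟩ := Nat.exists_eq_add_of_le' hN
    rw [Nat.add_sub_cancel, mul_right_comm (a₀ ^ 2), ← hτ]
    have h := toep_bilinear_first_last hy₁ ν m
    rw [g₀, g₀, g₁] at h
    apply mul_left_cancel₀ (hτN (m + 1))
    have e : τ ^ (m + 1) * (1 / τ) = τ ^ m := by field_simp; ring
    linear_combination -h - toep y (ν + 1) (m + 2) * toep x ν m * e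
  · have h := toep_bilinear_shift_both (pow_ne_zero 2 hc0).isUnit hx hy hζ ν N
    rw [g₀, g₂, z₀] at h
    have e : q ^ (2 * (N + 1)) = q ^ (2 * N) * q ^ 2 := by ring
    rw [e] at h
    rw [← mul_assoc (a₀ ^ 2 * c ^ 2), ← hτ]
    field_simp at h ⊢
    apply mul_left_cancel₀ (hτN N)
    linear_combination h
  · have h := toep_bilinear_succ_succ hx hy hζ ν N
    rw [g₀, g₀, g₁, z₀] at h
    apply mul_left_cancel₀ (hτN N)
    linear_combination h - τ ^ N * toep x (ν + 1) N * toep x ν (N + 1) * hτ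
  · intro hN
    obtain ⟨m, rfl⟩ := Nat.exists_eq_add_of_le' hN
    rw [Nat.add_sub_cancel]
    have h := toep_bilinear_succ_size hx hy hζ ν m
    rw [g₀, g₀, z₁] at h
    apply mul_left_cancel₀ (hτN (m + 1))
    linear_combination a₀ ^ 2 * q ^ (2 * ν) * h
      + τ ^ m * toep x (ν + 1) (m + 2) * toep x ν m * hτ
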